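/- Let $\mathbb S^2\subset\mathbb R^3$ be the unit sphere with its rotation-invariant surface measure $\mu$ and let $C^\infty(\mathbb S^2)$ be the space of smooth real functions on it. Let $Y_{lm}$ ($l\ge 0$, $-l\le m\le l$) be the real spherical harmonics, normalized in $L^2(\mathbb S^2,\mu)$. Let $L^2=-(X_1^2+X_2^2+X_3^2)$ be the squared angular momentum operator, where $X_i$ is the infinitesimal rotation about the $i$-th coordinate axis (so $L^2Y_{lm}=l(l+1)Y_{lm}$). Fix a real number $k>1$, put $A=L^2+k$, and give $C^\infty(\mathbb S^2)$ the Fréchet topology $\tau$ defined by the norms $\|f\|_p=\|A^pf\|_{L^2(\mathbb S^2)}$, $p=0,1,2,\dots$. Let $T^4$ be the linear span of the four functions $Y_{lm}$ with $l\le 1$, and let $ST$ be the $\tau$-closure of the linear span of the functions $Y_{lm}$ with $l>1$. Then $T^4$ and $ST$ are closed, and $$C^\infty(\mathbb S^2)=T^4\oplus ST$$ is a topological direct sum: every $f\in C^\infty(\mathbb S^2)$ is in exactly one way the sum of an element of $T^4$ and an element of $ST$, and the projection onto $T^4$ along $ST$ is continuous. Moreover, let $f\in C^\infty(\mathbb S^2)$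 and $\alpha_{lm}=\int_{\mathbb S^2}f\,Y_{lm}\,d\mu$. Then $$\lim_{n\to\infty}\Big\|A^p\Big(f-\sum_{l=0}^n\sum_{m=-l}^l\alpha_{lm}Y_{lm}\Big)\Big\|_{L^2(\mathbb S^2)}=0\quad\text{for every } p\ge 0,$$ hence $\sum_{l=0}^n\sum_{m=-l}^l\alpha_{lm}Y_{lm}\to f$ in $\tau$. The expansion is unique: if real numbers $c_{lm}$ are such that $\sum_{l=0}^n\sum_{m=-l}^l c_{lm}Y_{lm}\to f$ in $\tau$, then $c_{lm}=\alpha_{lm}$ for all $l\ge0$ and $|m|\le l$. -/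

import Mathlib

open MeasureTheory Filter Topology Metric
open scoped Manifold ContDiff

namespace SphericalDecomposition

noncomputable section

/-- The unit two-sphere in Euclidean three-space. -/
abbrev S2 : Type := sphere (0 : EuclideanSpace ℝ (Fin 3)) 1

/-- The dimension hypothesis under which Mathlib makes the sphere a smooth manifold. -/
instance factFinrank : Fact (Module.finrank ℝ (EuclideanSpace ℝ (Fin 3)) = 2 + 1) :=
  ⟨by simp⟩

/-- The real vector space of smooth real functions on the two-sphere. -/
abbrev SmoothFun : Type := C^∞⟮𝓡 2, S2; 𝓘(ℝ, ℝ), ℝ⟯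

/-- The rotation-invariant surface measure of the two-sphere, of total mass `4 * π`. -/
abbrev surfaceMeasure : Measure S2 :=
  (volume : Measure (EuclideanSpace ℝ (Fin 3))).toSphere

/-- Rotation of Euclidean three-space by the angle `t` about the `i`-th coordinate axis: it fixes
the coordinate `i` and rotates the coordinate plane `(i + 1, i + 2)` (indices modulo three). -/
def rotVec (i : Fin 3) (t : ℝ) (x : EuclideanSpace ℝ (Fin 3)) : EuclideanSpace ℝ (Fin 3) :=
  WithLp.toLp 2 fun j =>
    if j = i then x i
    else if j = i + 1 then Real.cos t * x (i + 1) - Real.sin t * x (i + 2)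
    else Real.sin t * x (i + 1) + Real.cos t * x (i + 2)

theorem norm_rotVec (i : Fin 3) (t : ℝ) (x : EuclideanSpace ℝ (Fin 3)) :
    ‖rotVec i t x‖ = ‖x‖ := by
  have h := Real.sin_sq_add_cos_sq t
  rw [EuclideanSpace.norm_eq, EuclideanSpace.norm_eq]
  congr 1
  fin_cases i <;> simp [rotVec, Fin.sum_univ_three] <;> grind

theorem rotVec_mem (i : Fin 3) (t : ℝ) (x : S2) : rotVec i t (x : EuclideanSpace ℝ (Fin 3)) ∈
    sphere (0 : EuclideanSpace ℝ (Fin 3)) 1 := by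
  simp [norm_rotVec]

/-- The one-parameter group of rotations about the `i`-th axis, acting on the sphere. -/
def rot (i : Fin 3) (t : ℝ) (x : S2) : S2 := ⟨rotVec i t x, rotVec_mem i t x⟩

theorem contDiff_rotVec (i : Fin 3) :
    ContDiff ℝ ∞ fun q : EuclideanSpace ℝ (Fin 3) × ℝ => rotVec i q.2 q.1 := by
  rw [contDiff_euclidean]
  intro j
  simp only [rotVec]
  split_ifs <;> fun_prop

theorem contMDiff_rot (i : Fin 3) :
    ContMDiff ((𝓡 2).prod 𝓘(ℝ, ℝ)) (𝓡 2) ∞ fun q : S2 × ℝ => rot i q.2 q.1 := by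
  have h1 : ContMDiff ((𝓡 2).prod 𝓘(ℝ, ℝ)) 𝓘(ℝ, EuclideanSpace ℝ (Fin 3) × ℝ) ∞
      fun q : S2 × ℝ => ((q.1 : EuclideanSpace ℝ (Fin 3)), q.2) :=
    (contMDiff_coe_sphere.comp contMDiff_fst).prodMk_space contMDiff_snd
  exact ((contDiff_rotVec i).contMDiff.comp h1).codRestrict_sphere
    (fun q => rotVec_mem i q.2 q.1)

theorem contMDiff_slice (i : Fin 3) (f : SmoothFun) :
    ContMDiff ((𝓡 2).prod 𝓘(ℝ, ℝ)) 𝓘(ℝ, ℝ) ∞ fun q : S2 × ℝ => f (rot i q.2 q.1) :=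
  f.contMDiff.comp (contMDiff_rot i)

theorem contMDiff_generator (i : Fin 3) (f : SmoothFun) :
    ContMDiff (𝓡 2) 𝓘(ℝ, ℝ) ∞ fun x : S2 => deriv (fun t : ℝ => f (rot i t x)) 0 := by
  intro x
  have h := ContMDiffAt.mfderiv_apply (I := 𝓘(ℝ, ℝ)) (I' := 𝓘(ℝ, ℝ)) (m := ∞) (n := ∞)
    (x₀ := x) (fun (y : S2) (t : ℝ) => f (rot i t y)) (fun _ : S2 => (0 : ℝ)) (fun y : S2 => y)
    (fun _ : S2 => (1 : ℝ)) (contMDiff_slice i f _) contMDiffAt_const contMDiffAt_id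
    contMDiffAt_const le_rfl
  simpa [inTangentCoordinates_model_space, mfderiv_eq_fderiv] using h

theorem differentiableAt_slice (i : Fin 3) (f : SmoothFun) (x : S2) (t : ℝ) :
    DifferentiableAt ℝ (fun s : ℝ => f (rot i s x)) t := by
  have h0 : ContMDiff 𝓘(ℝ, ℝ) ((𝓡 2).prod 𝓘(ℝ, ℝ)) ∞ fun s : ℝ => (x, s) :=
    contMDiff_const.prodMk contMDiff_id
  have h : ContMDiff 𝓘(ℝ, ℝ) 𝓘(ℝ, ℝ) ∞ fun s : ℝ => f (rot i s x) :=
    ContMDiff.comp (g := fun q : S2 × ℝ => f (rot i q.2 q.1)) (f := fun s : ℝ => (x, s))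
      (contMDiff_slice i f) h0
  exact (h.contDiff.differentiable (by simp)).differentiableAt

/-- The infinitesimal rotation about the `i`-th axis, that is, the derivative at `t = 0` of
`f ∘ rot i t`, as an operator on smooth functions. -/
def generator (i : Fin 3) : SmoothFun →ₗ[ℝ] SmoothFun where
  toFun f := ⟨fun x => deriv (fun t : ℝ => f (rot i t x)) 0, contMDiff_generator i f⟩
  map_add' f g := by
    ext x
    exact deriv_add (differentiableAt_slice i f x 0) (differentiableAt_slice i g x 0)
  map_smul' c f := by
    ext x
    exact deriv_const_mul c (differentiableAt_slice i f x 0)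

/-- The squared angular momentum `L²`: minus the sum of the squares of the three infinitesimal
rotations. -/
def angularMomentumSq : SmoothFun →ₗ[ℝ] SmoothFun :=
  -∑ i : Fin 3, generator i ∘ₗ generator i

/-- The operator `A = L² + k`. -/
def opA (k : ℝ) : Module.End ℝ SmoothFun :=
  angularMomentumSq + k • LinearMap.id

/-- The class in `L²(S2)` of a smooth function. -/
def toL2 : SmoothFun →ₗ[ℝ] Lp ℝ 2 surfaceMeasure where
  toFun f := ContinuousMap.toLp 2 surfaceMeasure ℝ ⟨f, f.contMDiff.continuous⟩
  map_add' f g := (ContinuousMap.toLp 2 surfaceMeasure ℝ).map_add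
    ⟨f, f.contMDiff.continuous⟩ ⟨g, g.contMDiff.continuous⟩
  map_smul' c f := (ContinuousMap.toLp 2 surfaceMeasure ℝ).map_smul c
    ⟨f, f.contMDiff.continuous⟩

/-- The family of norms `f ↦ ‖A ^ p f‖`, `p = 0, 1, 2, …`, with the norm of `L²(S2)`. -/
def normFamily (k : ℝ) : SeminormFamily ℝ SmoothFun ℕ := fun p =>
  (normSeminorm ℝ (Lp ℝ 2 surfaceMeasure)).comp (toL2 ∘ₗ (opA k ^ p))

/-- The locally convex topology of the space of smooth functions that is defined by the norms
`f ↦ ‖A ^ p f‖`. -/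
@[reducible] def frechetTopology (k : ℝ) : TopologicalSpace SmoothFun :=
  (normFamily k).moduleFilterBasis.topology

theorem withSeminorms (k : ℝ) :
    @WithSeminorms ℝ SmoothFun ℕ _ _ _ (normFamily k) (frechetTopology k) :=
  @WithSeminorms.mk ℝ SmoothFun ℕ _ _ _ (normFamily k) (frechetTopology k) rfl

/-- The closure of a subspace in the topology defined by the norms `f ↦ ‖A ^ p f‖`. -/
def closedSubspace (k : ℝ) (V : Submodule ℝ SmoothFun) : Submodule ℝ SmoothFun :=
  letI := frechetTopology k
  haveI : IsTopologicalAddGroup SmoothFun := (withSeminorms k).topologicalAddGroup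
  haveI : ContinuousSMul ℝ SmoothFun := (withSeminorms k).continuousSMul
  V.topologicalClosure

/-- The Legendre polynomial of degree `l`, by the formula of Rodrigues. -/
def legendre (l : ℕ) : Polynomial ℝ :=
  Polynomial.C (1 / (2 ^ l * (l.factorial : ℝ))) *
    Polynomial.derivative^[l] ((Polynomial.X ^ 2 - 1) ^ l)

/-- The real spherical harmonic of degree `l` and order `m` before normalization. At the point with
`x 0 = sin θ cos φ`, `x 1 = sin θ sin φ`, `x 2 = cos θ` its value is `(sin θ) ^ |m|` times the
`|m|`-th derivative of the Legendre polynomial at `cos θ`, times `cos (|m| φ)` if `0 ≤ m` and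
`sin (|m| φ)` if `m < 0`. -/
def rawHarmonic (l : ℕ) (m : ℤ) : SmoothFun :=
  ⟨fun x => (Polynomial.derivative^[m.natAbs] (legendre l)).eval ((x : EuclideanSpace ℝ (Fin 3)) 2) *
      (if 0 ≤ m then
        (((⟨(x : EuclideanSpace ℝ (Fin 3)) 0, (x : EuclideanSpace ℝ (Fin 3)) 1⟩ : ℂ)) ^ m.natAbs).re
      else
        (((⟨(x : EuclideanSpace ℝ (Fin 3)) 0, (x : EuclideanSpace ℝ (Fin 3)) 1⟩ : ℂ)) ^ m.natAbs).im),
    by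
      have hz : ContDiff ℝ ∞ fun y : EuclideanSpace ℝ (Fin 3) => (⟨y 0, y 1⟩ : ℂ) := by
        have h : (fun y : EuclideanSpace ℝ (Fin 3) => (⟨y 0, y 1⟩ : ℂ)) =
            fun y => Complex.equivRealProdCLM.symm (y 0, y 1) := by
          ext y
          rfl
        rw [h]
        fun_prop
      have hp : ContDiff ℝ ∞ fun y : EuclideanSpace ℝ (Fin 3) =>
          (Polynomial.derivative^[m.natAbs] (legendre l)).eval (y 2) :=
        by
        have h := (Polynomial.derivative^[m.natAbs] (legendre l)).contDiff_aeval (𝕜 := ℝ) ∞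
        simp only [Polynomial.coe_aeval_eq_eval] at h
        have h2 : ContDiff ℝ ∞ fun y : EuclideanSpace ℝ (Fin 3) => y 2 := by fun_prop
        exact h.comp h2
      have hre := Complex.reCLM.contDiff.comp (hz.pow m.natAbs)
      have him := Complex.imCLM.contDiff.comp (hz.pow m.natAbs)
      split_ifs
      · exact (hp.mul hre).contMDiff.comp contMDiff_coe_sphere
      · exact (hp.mul him).contMDiff.comp contMDiff_coe_sphere⟩

/-- The real spherical harmonic `Y l m`, normalized to have norm one in `L²(S2)`; it is meant for
`|m| ≤ l` (for other `m` it is zero). -/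
def Y (l : ℕ) (m : ℤ) : SmoothFun := ‖toL2 (rawHarmonic l m)‖⁻¹ • rawHarmonic l m

/-- The span of the spherical harmonics with `l ≤ 1`. -/
def T4 : Submodule ℝ SmoothFun :=
  Submodule.span ℝ {f | ∃ (l : ℕ) (m : ℤ), l ≤ 1 ∧ |m| ≤ (l : ℤ) ∧ f = Y l m}

/-- The closed span of the spherical harmonics with `l > 1`. -/
def ST (k : ℝ) : Submodule ℝ SmoothFun :=
  closedSubspace k
    (Submodule.span ℝ {f | ∃ (l : ℕ) (m : ℤ), 1 < l ∧ |m| ≤ (l : ℤ) ∧ f = Y l m})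

/-- The coefficient of the spherical harmonic `Y l m` in the expansion of `f`. -/
def coeff (f : SmoothFun) (l : ℕ) (m : ℤ) : ℝ := ∫ x, f x * Y l m x ∂surfaceMeasure

/-- The partial sum over `0 ≤ l ≤ n`, `-l ≤ m ≤ l` of the series with coefficients `c`. -/
def partialSum (c : ℕ → ℤ → ℝ) (n : ℕ) : SmoothFun :=
  ∑ l ∈ Finset.range (n + 1), ∑ m ∈ Finset.Icc (-(l : ℤ)) l, c l m • Y l m

end

end SphericalDecomposition

namespace SphericalDecomposition

noncomputable section

/-! ### Rotations and the surface measure -/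

/-! The harmonics form a Hilbert basis of L² (`harmonicBasis`) that diagonalizes the symmetric
operator A. By `inner_opA_pow` and `opA_pow_Y`, the coefficients of A^p f are (l(l+1)+k)^p α_lm. So
A^p maps the partial sums of f to those of A^p f, and these converge in L² because A^p f is again
smooth (`tendsto_opA_pow_partialSum`). No estimate on the decay of the α_lm is needed. The norm with
p = 0 makes each coefficient continuous for τ. This gives uniqueness and a continuous projection
`projT4`, whose range is `T4` and whose kernel is `ST` by convergence of the expansion
(`ker_projT4`). The Hilbert basis has three ingredients. Rotation invariance of the measure makes
each X_i skew-symmetric (`inner_rotDer`). The derivation rules and the Legendre equation give the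
eigenvalues (`angularMomentumSq_rawHarmonic`), and with them orthogonality. Finally, the span of the
harmonics contains all polynomials in the coordinates (`adjoin_coordFun_le_harmonicSpan`), which are
dense by Stone–Weierstrass. -/

theorem rotVec_zero (i : Fin 3) (x : EuclideanSpace ℝ (Fin 3)) : rotVec i 0 x = x := by
  ext j
  fin_cases i <;> fin_cases j <;> simp [rotVec]

theorem rotVec_add (i : Fin 3) (s t : ℝ) (x : EuclideanSpace ℝ (Fin 3)) :
    rotVec i (s + t) x = rotVec i s (rotVec i t x) := by
  ext j
  fin_cases i <;> fin_cases j <;> simp [rotVec, Real.cos_add, Real.sin_add] <;> ring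

theorem rot_zero (i : Fin 3) (x : S2) : rot i 0 x = x := Subtype.ext (rotVec_zero i x)

theorem rot_add (i : Fin 3) (s t : ℝ) (x : S2) : rot i (s + t) x = rot i s (rot i t x) :=
  Subtype.ext (rotVec_add i s t x)

/-- Rotation by the angle `t` about the `i`-th axis as a linear isometric equivalence. -/
def rotIso (i : Fin 3) (t : ℝ) : EuclideanSpace ℝ (Fin 3) ≃ₗᵢ[ℝ] EuclideanSpace ℝ (Fin 3) where
  toFun := rotVec i t
  invFun := rotVec i (-t)
  left_inv x := by rw [← rotVec_add, neg_add_cancel, rotVec_zero]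
  right_inv x := by rw [← rotVec_add, add_neg_cancel, rotVec_zero]
  map_add' x y := by
    ext j
    simp only [rotVec, PiLp.add_apply]
    split_ifs <;> ring
  map_smul' c x := by
    ext j
    simp only [rotVec, PiLp.smul_apply, smul_eq_mul, RingHom.id_apply]
    split_ifs <;> ring
  norm_map' := norm_rotVec i t

theorem continuous_rot (i : Fin 3) (t : ℝ) : Continuous (rot i t) :=
  (((rotIso i t).continuous.comp continuous_subtype_val).subtype_mk _)

/-- The surface measure of a set is a multiple of the volume of the cone over it. Forming cones
commutes with linear isometries, and these preserve volume. -/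
theorem measurePreserving_rot (i : Fin 3) (t : ℝ) :
    MeasurePreserving (rot i t) surfaceMeasure surfaceMeasure := by
  refine ⟨(continuous_rot i t).measurable, Measure.ext fun s hs => ?_⟩
  have hs' := (continuous_rot i t).measurable hs
  rw [Measure.map_apply (continuous_rot i t).measurable hs, Measure.toSphere_apply' _ hs',
    Measure.toSphere_apply' _ hs]
  congr 1
  conv_rhs => rw [← (rotIso i t).measurePreserving.measure_preimage_emb
    (rotIso i t).toHomeomorph.measurableEmbedding]
  congr 1
  ext x
  simp only [Set.mem_smul, Set.mem_image, Set.mem_preimage]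
  constructor
  · rintro ⟨r, hr, _, ⟨y, hy, rfl⟩, rfl⟩
    exact ⟨r, hr, _, ⟨_, hy, rfl⟩, ((rotIso i t).map_smul r (y : EuclideanSpace ℝ (Fin 3))).symm⟩
  · rintro ⟨r, hr, _, ⟨y, hy, rfl⟩, h⟩
    refine ⟨r, hr, _, ⟨rot i (-t) y, ?_, rfl⟩, (rotIso i t).injective ?_⟩
    · rwa [← rot_add, add_neg_cancel, rot_zero]
    · rw [← h, map_smul]
      congr 1
      exact (congrArg Subtype.val (rot_add i t (-t) y)).symm.trans
        (by rw [add_neg_cancel, rot_zero])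

/-- The group law reduces the derivative at time t to the one at time 0, taken at the rotated point.
-/
theorem hasDerivAt_comp_rot (i : Fin 3) (f : SmoothFun) (x : S2) (t : ℝ) :
    HasDerivAt (fun s : ℝ => f (rot i s x)) (generator i f (rot i t x)) t := by
  have h : HasDerivAt (fun s : ℝ => f (rot i s (rot i t x))) (generator i f (rot i t x))
      (t - t) := by
    rw [sub_self]
    exact (differentiableAt_slice i f (rot i t x) 0).hasDerivAt
  have h2 := HasDerivAt.comp (h := fun s : ℝ => s - t) t h ((hasDerivAt_id t).sub_const t)
  rw [mul_one] at h2
  refine h2.congr_of_eventuallyEq (Eventually.of_forall fun s => ?_)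
  simp [← rot_add]

theorem integrable_smoothFun (f : SmoothFun) : Integrable f surfaceMeasure :=
  f.contMDiff.continuous.integrable_of_hasCompactSupport (HasCompactSupport.of_compactSpace _)

/-- By invariance the integral of f ∘ rot i t does not depend on t; differentiate it under the
integral sign. Applied to products, this is integration by parts. -/
theorem integral_generator (i : Fin 3) (f : SmoothFun) :
    ∫ x, generator i f x ∂surfaceMeasure = 0 := by
  -- Compactness gives one constant that dominates the derivative for all t.
  obtain ⟨C, hC⟩ := isCompact_univ.exists_bound_of_continuousOn
    (generator i f).contMDiff.continuous.continuousOn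
  have hF : ∀ g : SmoothFun, ∀ t, AEStronglyMeasurable (fun x => g (rot i t x)) surfaceMeasure :=
    fun g t => (g.contMDiff.continuous.comp (continuous_rot i t)).aestronglyMeasurable
  have h := (hasDerivAt_integral_of_dominated_loc_of_deriv_le (μ := surfaceMeasure)
    (F := fun t x => f (rot i t x)) (F' := fun t x => generator i f (rot i t x)) (x₀ := (0 : ℝ))
    (bound := fun _ => C) univ_mem (Eventually.of_forall (hF f))
    (by simpa only [rot_zero] using integrable_smoothFun f) (hF _ 0)
    (Eventually.of_forall fun x t _ => hC _ (Set.mem_univ _)) (integrable_const C)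
    (Eventually.of_forall fun x t _ => hasDerivAt_comp_rot i f x t)).2
  have hc : (fun t : ℝ => ∫ x, f (rot i t x) ∂surfaceMeasure) =
      fun _ => ∫ x, f x ∂surfaceMeasure := by
    ext t
    have hm := measurePreserving_rot i t
    conv_rhs => rw [← hm.map_eq]
    exact (integral_map hm.measurable.aemeasurable
      f.contMDiff.continuous.aestronglyMeasurable).symm
  rw [hc] at h
  simpa only [rot_zero] using h.unique (hasDerivAt_const _ _)

/-! ### Infinitesimal rotations as derivations -/

/-- Evaluation of smooth functions at a point, as a homomorphism of algebras. -/
def evalAt (x : S2) : SmoothFun →ₐ[ℝ] ℝ where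
  toFun f := f x
  map_one' := rfl
  map_mul' _ _ := rfl
  map_zero' := rfl
  map_add' _ _ := rfl
  commutes' _ := rfl

theorem generator_mul (i : Fin 3) (f g : SmoothFun) :
    generator i (f * g) = f * generator i g + g * generator i f := by
  ext x
  have h := ((differentiableAt_slice i f x 0).hasDerivAt.mul
    (differentiableAt_slice i g x 0).hasDerivAt).deriv
  rw [rot_zero] at h
  refine h.trans ?_
  change _ = f x * deriv (fun t : ℝ => g (rot i t x)) 0 + g x * deriv (fun t : ℝ => f (rot i t x)) 0
  ring

/-- The infinitesimal rotation about the `i`-th axis as a derivation. -/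
def rotDer (i : Fin 3) : Derivation ℝ SmoothFun SmoothFun :=
  Derivation.mk' (generator i) (generator_mul i)

/-- The `j`-th coordinate function on the sphere. -/
def coordFun (j : Fin 3) : SmoothFun :=
  ⟨fun x => (x : EuclideanSpace ℝ (Fin 3)) j, by
    have h : ContDiff ℝ ∞ fun y : EuclideanSpace ℝ (Fin 3) => y j := by fun_prop
    exact h.contMDiff.comp contMDiff_coe_sphere⟩

theorem coordFun_sq_add : coordFun 0 ^ 2 + coordFun 1 ^ 2 + coordFun 2 ^ 2 = (1 : SmoothFun) := by
  ext x
  have h : ‖(x : EuclideanSpace ℝ (Fin 3))‖ ^ 2 = 1 := by simp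
  rw [EuclideanSpace.norm_sq_eq, Fin.sum_univ_three] at h
  simp only [Real.norm_eq_abs, sq_abs] at h
  exact h

theorem rotDer_coordFun_self (i : Fin 3) : rotDer i (coordFun i) = 0 := by
  ext x
  change deriv (fun t : ℝ => rotVec i t x i) 0 = 0
  simp [rotVec]

theorem rotDer_coordFun_add_one (i : Fin 3) :
    rotDer i (coordFun (i + 1)) = -coordFun (i + 2) := by
  ext x
  change deriv (fun t : ℝ => rotVec i t x (i + 1)) 0 = -(x : EuclideanSpace ℝ (Fin 3)) (i + 2)
  simp [rotVec]

theorem rotDer_coordFun_add_two (i : Fin 3) :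
    rotDer i (coordFun (i + 2)) = coordFun (i + 1) := by
  ext x
  change deriv (fun t : ℝ => rotVec i t x (i + 2)) 0 = (x : EuclideanSpace ℝ (Fin 3)) (i + 1)
  have h1 : i + 2 ≠ i := by fin_cases i <;> decide
  have h2 : i + 2 ≠ i + 1 := by fin_cases i <;> decide
  simp [rotVec, h1, h2]

theorem angularMomentumSq_apply (f : SmoothFun) : angularMomentumSq f =
    -(rotDer 0 (rotDer 0 f) + rotDer 1 (rotDer 1 f) + rotDer 2 (rotDer 2 f)) := by
  simp only [angularMomentumSq, LinearMap.neg_apply, Fin.sum_univ_three]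
  rfl

/-! ### Legendre polynomials -/

section Legendre

open Polynomial

/-- With u = (X² - 1)^l one has (X² - 1)u' = 2lXu. One differentiation gives the case n = 0, and
each further one raises n by 1. -/
theorem iterate_derivative_sq_sub_one_pow (l n : ℕ) :
    (X ^ 2 - 1 : ℝ[X]) * derivative^[n + 2] ((X ^ 2 - 1) ^ l) +
      (2 * ((n : ℝ[X]) + 1 - (l : ℝ[X]))) * (X * derivative^[n + 1] ((X ^ 2 - 1) ^ l)) +
      ((n : ℝ[X]) + 1) * ((n : ℝ[X]) - 2 * (l : ℝ[X])) * derivative^[n] ((X ^ 2 - 1) ^ l) = 0 := by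
  induction n with
  | zero =>
    have h : (X ^ 2 - 1 : ℝ[X]) * derivative ((X ^ 2 - 1) ^ l) =
        2 * (l : ℝ[X]) * (X * (X ^ 2 - 1) ^ l) := by
      cases l with
      | zero => simp
      | succ l =>
        simp only [derivative_pow, derivative_sub, derivative_one, derivative_X, Nat.cast_succ,
          map_add, map_one, map_natCast, Nat.add_sub_cancel]
        simp
        ring
    have h2 := congrArg derivative h
    simp only [derivative_mul, derivative_sub, derivative_X_pow, derivative_one, derivative_X,
      derivative_natCast, derivative_ofNat] at h2
    simp only [Function.iterate_succ_apply', Function.iterate_zero_apply, zero_add]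
    push_cast at h2 ⊢
    simp only [map_ofNat] at h2
    linear_combination h2
  | succ n ih =>
    have h2 := congrArg derivative ih
    simp only [derivative_mul, derivative_sub, derivative_X_pow, derivative_one, derivative_X,
      derivative_natCast, derivative_ofNat, derivative_add, derivative_zero] at h2
    simp only [Function.iterate_succ_apply'] at h2 ⊢
    push_cast at h2 ⊢
    simp only [map_ofNat] at h2
    linear_combination h2

/-- The differential equation of the derivatives of the Legendre polynomials. -/
theorem legendre_differential_equation (l m : ℕ) :
    (X ^ 2 - 1 : ℝ[X]) * derivative^[m + 2] (legendre l) +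
      (2 * ((m : ℝ[X]) + 1)) * (X * derivative^[m + 1] (legendre l)) =
      ((l : ℝ[X]) * ((l : ℝ[X]) + 1) - (m : ℝ[X]) * ((m : ℝ[X]) + 1)) *
        derivative^[m] (legendre l) := by
  -- Rodrigues' formula already contains l derivatives. At n = m + l the last coefficient is
  -- (m+l+1)(m-l) = m(m+1) - l(l+1).
  have h := iterate_derivative_sq_sub_one_pow l (m + l)
  rw [add_right_comm m l 2, add_right_comm m l 1] at h
  simp only [legendre, iterate_derivative_C_mul, ← Function.iterate_add_apply]
  push_cast at h
  linear_combination C (1 / (2 ^ l * (l.factorial : ℝ))) * h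

theorem degree_iterate_derivative_of_natDegree_eq {p : ℝ[X]} {n k : ℕ} (hp : p ≠ 0)
    (h : p.natDegree = n + k) : (derivative^[k] p).degree = n := by
  have hc : (derivative^[k] p).coeff n ≠ 0 := by
    rw [coeff_iterate_derivative, ← h, nsmul_eq_mul]
    refine mul_ne_zero ?_ (leadingCoeff_ne_zero.2 hp)
    rw [Nat.cast_ne_zero, Ne, Nat.descFactorial_eq_zero_iff_lt]
    omega
  refine le_antisymm ?_ (le_degree_of_ne_zero hc)
  refine natDegree_le_iff_degree_le.1 ((natDegree_iterate_derivative p k).trans ?_)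
  omega

theorem degree_iterate_derivative_legendre (l m : ℕ) :
    (derivative^[m] (legendre (m + l))).degree = l := by
  have hq : (X ^ 2 - 1 : ℝ[X]).natDegree = 2 := natDegree_X_pow_sub_C (r := 1)
  have hq0 : (X ^ 2 - 1 : ℝ[X]) ≠ 0 := fun h => by simp [h] at hq
  rw [legendre, iterate_derivative_C_mul, ← Function.iterate_add_apply,
    degree_C_mul (by positivity)]
  refine degree_iterate_derivative_of_natDegree_eq (pow_ne_zero _ hq0) ?_
  rw [natDegree_pow, hq]
  ring

end Legendre

/-! ### Harmonic polynomials in the first two coordinates -/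

/-- The real part of `(x + i y) ^ m` (first component) and its imaginary part (second component),
as smooth functions on the sphere. -/
def planarHarmonic : ℕ → SmoothFun × SmoothFun
  | 0 => (1, 0)
  | m + 1 => (coordFun 0 * (planarHarmonic m).1 - coordFun 1 * (planarHarmonic m).2,
      coordFun 0 * (planarHarmonic m).2 + coordFun 1 * (planarHarmonic m).1)

/-- The real part of `(x + i y) ^ m`. -/
def planarRe (m : ℕ) : SmoothFun := (planarHarmonic m).1

/-- The imaginary part of `(x + i y) ^ m`. -/
def planarIm (m : ℕ) : SmoothFun := (planarHarmonic m).2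

theorem planarRe_zero : planarRe 0 = 1 := rfl

theorem planarIm_zero : planarIm 0 = 0 := rfl

theorem planarRe_succ (m : ℕ) :
    planarRe (m + 1) = coordFun 0 * planarRe m - coordFun 1 * planarIm m := rfl

theorem planarIm_succ (m : ℕ) :
    planarIm (m + 1) = coordFun 0 * planarIm m + coordFun 1 * planarRe m := rfl

theorem planarHarmonic_eval (m : ℕ) (x : S2) :
    (⟨(x : EuclideanSpace ℝ (Fin 3)) 0, (x : EuclideanSpace ℝ (Fin 3)) 1⟩ : ℂ) ^ m =
      ⟨planarRe m x, planarIm m x⟩ := by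
  induction m with
  | zero => rfl
  | succ m ih =>
    rw [pow_succ', ih]
    rfl

theorem rotDer_zero_coordFun_one : rotDer 0 (coordFun 1) = -coordFun 2 :=
  rotDer_coordFun_add_one 0

theorem rotDer_zero_coordFun_two : rotDer 0 (coordFun 2) = coordFun 1 :=
  rotDer_coordFun_add_two 0

theorem rotDer_one_coordFun_two : rotDer 1 (coordFun 2) = -coordFun 0 :=
  rotDer_coordFun_add_one 1

theorem rotDer_one_coordFun_zero : rotDer 1 (coordFun 0) = coordFun 2 :=
  rotDer_coordFun_add_two 1

theorem rotDer_two_coordFun_zero : rotDer 2 (coordFun 0) = -coordFun 1 :=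
  rotDer_coordFun_add_one 2

theorem rotDer_two_coordFun_one : rotDer 2 (coordFun 1) = coordFun 0 :=
  rotDer_coordFun_add_two 2

/-- With w = x + iy, the first infinitesimal rotation sends w to -iz, the second to z and the third
to iw. This lemma and the next two are the real and imaginary parts of the power rule for w^m. -/
theorem rotDer_zero_planar (m : ℕ) :
    rotDer 0 (planarRe (m + 1)) = ((m : SmoothFun) + 1) * (coordFun 2 * planarIm m) ∧
      rotDer 0 (planarIm (m + 1)) = -(((m : SmoothFun) + 1) * (coordFun 2 * planarRe m)) := by
  induction m with
  | zero =>
    simp [planarRe_succ, planarIm_succ, planarRe_zero, planarIm_zero, rotDer_coordFun_self,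
      rotDer_zero_coordFun_one]
  | succ m ih =>
    rw [planarRe_succ (m + 1), planarIm_succ (m + 1)]
    simp only [map_sub, map_add, Derivation.leibniz, smul_eq_mul, ih.1, ih.2, rotDer_coordFun_self,
      rotDer_zero_coordFun_one]
    constructor
    · rw [planarRe_succ, planarIm_succ]
      push_cast
      ring
    · rw [planarRe_succ, planarIm_succ]
      push_cast
      ring

theorem rotDer_one_planar (m : ℕ) :
    rotDer 1 (planarRe (m + 1)) = ((m : SmoothFun) + 1) * (coordFun 2 * planarRe m) ∧
      rotDer 1 (planarIm (m + 1)) = ((m : SmoothFun) + 1) * (coordFun 2 * planarIm m) := by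
  induction m with
  | zero =>
    simp [planarRe_succ, planarIm_succ, planarRe_zero, planarIm_zero, rotDer_coordFun_self,
      rotDer_one_coordFun_zero]
  | succ m ih =>
    rw [planarRe_succ (m + 1), planarIm_succ (m + 1)]
    simp only [map_sub, map_add, Derivation.leibniz, smul_eq_mul, ih.1, ih.2, rotDer_coordFun_self,
      rotDer_one_coordFun_zero]
    constructor
    · rw [planarRe_succ, planarIm_succ]
      push_cast
      ring
    · rw [planarRe_succ, planarIm_succ]
      push_cast
      ring

theorem rotDer_two_planar (m : ℕ) :
    rotDer 2 (planarRe m) = -((m : SmoothFun) * planarIm m) ∧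
      rotDer 2 (planarIm m) = (m : SmoothFun) * planarRe m := by
  induction m with
  | zero => simp [planarRe_zero, planarIm_zero]
  | succ m ih =>
    rw [planarRe_succ, planarIm_succ]
    simp only [map_sub, map_add, Derivation.leibniz, smul_eq_mul, ih.1, ih.2,
      rotDer_two_coordFun_zero, rotDer_two_coordFun_one]
    constructor <;>
    · push_cast
      ring

/-! ### Squared angular momentum of zonal times planar functions -/

theorem angularMomentumSq_mul (f g : SmoothFun) : angularMomentumSq (f * g) =
    f * angularMomentumSq g + g * angularMomentumSq f - 2 * (rotDer 0 f * rotDer 0 g +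
      rotDer 1 f * rotDer 1 g + rotDer 2 f * rotDer 2 g) := by
  simp only [angularMomentumSq_apply, Derivation.leibniz, map_add, smul_eq_mul]
  ring

theorem angularMomentumSq_planar (m : ℕ) :
    angularMomentumSq (planarRe m) = ((m : SmoothFun) * (m + 1)) * planarRe m ∧
      angularMomentumSq (planarIm m) = ((m : SmoothFun) * (m + 1)) * planarIm m := by
  -- The formulas for `rotDer 0` and `rotDer 1` lower the exponent, so using them twice requires
  -- exponent at least 2.
  match m with
  | 0 => simp [angularMomentumSq_apply, planarRe_zero, planarIm_zero]
  | 1 =>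
    simp [angularMomentumSq_apply, planarRe_succ, planarIm_succ, planarRe_zero, planarIm_zero,
      rotDer_coordFun_self, rotDer_zero_coordFun_one, rotDer_zero_coordFun_two,
      rotDer_one_coordFun_two, rotDer_one_coordFun_zero, rotDer_two_coordFun_zero,
      rotDer_two_coordFun_one]
    constructor <;> ring
  | m + 2 =>
    simp only [angularMomentumSq_apply, rotDer_zero_planar, rotDer_one_planar,
      rotDer_two_planar (m + 2), Derivation.leibniz, map_neg, map_add, smul_eq_mul,
      Derivation.map_natCast, Derivation.map_one_eq_zero, rotDer_zero_coordFun_two,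
      rotDer_one_coordFun_two]
    simp only [planarRe_succ, planarIm_succ]
    push_cast
    constructor <;> ring

/-- The zonal function given by a polynomial in the third coordinate. -/
def zonal : Polynomial ℝ →ₐ[ℝ] SmoothFun := Polynomial.aeval (coordFun 2)

theorem rotDer_zonal (i : Fin 3) (P : Polynomial ℝ) :
    rotDer i (zonal P) = zonal (Polynomial.derivative P) * rotDer i (coordFun 2) :=
  Derivation.map_aeval _ _ _

theorem angularMomentumSq_zonal (P : Polynomial ℝ) : angularMomentumSq (zonal P) =
    zonal ((Polynomial.X ^ 2 - 1) * Polynomial.derivative^[2] P +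
      2 * (Polynomial.X * Polynomial.derivative P)) := by
  have h : zonal Polynomial.X = coordFun 2 := Polynomial.aeval_X _
  simp only [angularMomentumSq_apply, rotDer_zonal, Derivation.leibniz, map_neg, smul_eq_mul,
    rotDer_coordFun_self, rotDer_zero_coordFun_two, rotDer_one_coordFun_two,
    rotDer_zero_coordFun_one, rotDer_one_coordFun_zero, map_add, map_sub, map_mul, map_pow, h,
    map_one, map_ofNat, Function.iterate_succ_apply', Function.iterate_zero_apply]
  rw [map_zero]
  linear_combination (-zonal (Polynomial.derivative (Polynomial.derivative P))) * coordFun_sq_add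

/-- The cross terms of the product rule add up to 2mzP'(z)w^m with w = x + iy. They turn the factor
2 of the zonal case into 2(m+1), so the operator of `legendre_differential_equation` appears. -/
theorem angularMomentumSq_zonal_mul_planar (P : Polynomial ℝ) (m : ℕ) :
    angularMomentumSq (zonal P * planarRe m) =
      zonal ((Polynomial.X ^ 2 - 1) * Polynomial.derivative^[2] P +
      2 * ((m : Polynomial ℝ) + 1) * (Polynomial.X * Polynomial.derivative P) +
      (m : Polynomial ℝ) * ((m : Polynomial ℝ) + 1) * P) * planarRe m ∧
    angularMomentumSq (zonal P * planarIm m) =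
      zonal ((Polynomial.X ^ 2 - 1) * Polynomial.derivative^[2] P +
      2 * ((m : Polynomial ℝ) + 1) * (Polynomial.X * Polynomial.derivative P) +
      (m : Polynomial ℝ) * ((m : Polynomial ℝ) + 1) * P) * planarIm m := by
  have h : zonal Polynomial.X = coordFun 2 := Polynomial.aeval_X _
  simp only [angularMomentumSq_mul, angularMomentumSq_planar, angularMomentumSq_zonal,
    rotDer_zonal, rotDer_coordFun_self, rotDer_zero_coordFun_two, rotDer_one_coordFun_two,
    map_add, map_sub, map_mul, map_pow, h, map_one, map_ofNat, map_natCast]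
  cases m with
  | zero =>
    simp only [planarRe_zero, planarIm_zero, map_zero, Derivation.map_one_eq_zero, Nat.cast_zero]
    constructor <;> ring
  | succ m =>
    simp only [rotDer_zero_planar, rotDer_one_planar]
    simp only [planarRe_succ, planarIm_succ]
    push_cast
    constructor <;> ring

theorem zonal_apply (P : Polynomial ℝ) (x : S2) :
    zonal P x = P.eval ((x : EuclideanSpace ℝ (Fin 3)) 2) := by
  have h := Polynomial.aeval_algHom_apply (evalAt x) (coordFun 2) P
  rw [Polynomial.coe_aeval_eq_eval] at h
  exact h.symm

/-- The real part of `(x + i y) ^ |m|` if `0 ≤ m` and its imaginary part if `m < 0`. -/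
def planar (m : ℤ) : SmoothFun := if 0 ≤ m then planarRe m.natAbs else planarIm m.natAbs

theorem rawHarmonic_eq (l : ℕ) (m : ℤ) :
    rawHarmonic l m = zonal (Polynomial.derivative^[m.natAbs] (legendre l)) * planar m := by
  ext x
  have h := planarHarmonic_eval m.natAbs x
  change Polynomial.eval _ _ * (if _ then _ else _) = zonal _ x * planar m x
  rw [zonal_apply, h, planar]
  split_ifs <;> rfl

theorem rotDer_two_planar_int (m : ℤ) : rotDer 2 (planar m) = (-m) • planar (-m) := by
  rcases lt_trichotomy m 0 with h | rfl | h
  · lift -m to ℕ using by omega with n hn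
    obtain rfl : m = -n := by omega
    simp [planar, rotDer_two_planar, show n ≠ 0 by omega]
  · simp [planar, planarRe_zero]
  · lift m to ℕ using h.le with n
    simp [planar, rotDer_two_planar, show n ≠ 0 by omega]

theorem rotDer_two_rawHarmonic (l : ℕ) (m : ℤ) :
    rotDer 2 (rawHarmonic l m) = (-m : ℝ) • rawHarmonic l (-m) := by
  rw [rawHarmonic_eq, rawHarmonic_eq, Derivation.leibniz, rotDer_zonal, rotDer_coordFun_self,
    rotDer_two_planar_int, Int.natAbs_neg, ← Int.cast_neg, Int.cast_smul_eq_zsmul, smul_eq_mul,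
    mul_smul_comm]
  simp

theorem angularMomentumSq_rawHarmonic (l : ℕ) (m : ℤ) :
    angularMomentumSq (rawHarmonic l m) = ((l : ℝ) * (l + 1)) • rawHarmonic l m := by
  have h := legendre_differential_equation l m.natAbs
  have h2 := angularMomentumSq_zonal_mul_planar
    (Polynomial.derivative^[m.natAbs] (legendre l)) m.natAbs
  rw [← Function.iterate_succ_apply' Polynomial.derivative, ← Function.iterate_add_apply,
    add_comm 2, Nat.succ_eq_add_one, h, sub_mul, sub_add_cancel] at h2
  have h3 : zonal ((l : Polynomial ℝ) * ((l : Polynomial ℝ) + 1) *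
      Polynomial.derivative^[m.natAbs] (legendre l)) = ((l : ℝ) * (l + 1)) •
      zonal (Polynomial.derivative^[m.natAbs] (legendre l)) := by
    rw [← map_smul, Polynomial.smul_eq_C_mul]
    simp
  rw [h3, smul_mul_assoc, smul_mul_assoc] at h2
  rw [rawHarmonic_eq, planar]
  split_ifs
  exacts [h2.1, h2.2]

/-! ### Orthogonality of the spherical harmonics -/

open scoped InnerProductSpace

theorem inner_toL2 (f g : SmoothFun) :
    ⟪toL2 f, toL2 g⟫_ℝ = ∫ x, (f * g) x ∂surfaceMeasure := by
  refine (ContinuousMap.inner_toLp (𝕜 := ℝ) surfaceMeasure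
    ⟨f, f.contMDiff.continuous⟩ ⟨g, g.contMDiff.continuous⟩).trans ?_
  congr 1
  ext x
  exact mul_comm _ _

theorem inner_rotDer (i : Fin 3) (f g : SmoothFun) :
    ⟪toL2 (rotDer i f), toL2 g⟫_ℝ = -⟪toL2 f, toL2 (rotDer i g)⟫_ℝ := by
  have h : ∫ x, rotDer i (f * g) x ∂surfaceMeasure = 0 := integral_generator i (f * g)
  rw [eq_neg_iff_add_eq_zero, inner_toL2, inner_toL2, ← h,
    ← integral_add (integrable_smoothFun _) (integrable_smoothFun _), Derivation.leibniz]
  congr 1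
  ext x
  change rotDer i f x * g x + f x * rotDer i g x = f x * rotDer i g x + g x * rotDer i f x
  ring

theorem inner_angularMomentumSq (f g : SmoothFun) :
    ⟪toL2 (angularMomentumSq f), toL2 g⟫_ℝ = ⟪toL2 f, toL2 (angularMomentumSq g)⟫_ℝ := by
  simp only [angularMomentumSq_apply, map_neg, map_add, inner_neg_left, inner_neg_right,
    inner_add_left, inner_add_right, inner_rotDer, neg_neg]

theorem inner_opA_pow (k : ℝ) (p : ℕ) (f g : SmoothFun) :
    ⟪toL2 ((opA k ^ p) f), toL2 g⟫_ℝ = ⟪toL2 f, toL2 ((opA k ^ p) g)⟫_ℝ := by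
  induction p generalizing f g with
  | zero => rfl
  | succ p ih =>
    rw [pow_succ, Module.End.mul_apply, ih, ← pow_succ, pow_succ',
      Module.End.mul_apply]
    simp only [opA, LinearMap.add_apply, LinearMap.smul_apply, LinearMap.id_apply, map_add,
      map_smul, inner_add_left, inner_add_right, inner_angularMomentumSq, real_inner_smul_left,
      real_inner_smul_right]

theorem toL2_injective : Function.Injective toL2 := fun f g h => by
  have h2 := ContinuousMap.toLp_injective (p := 2) (𝕜 := ℝ) surfaceMeasure h
  ext x
  exact congrArg (fun u : C(S2, ℝ) => u x) h2

theorem rotDer_two_rotDer_two_rawHarmonic (l : ℕ) (m : ℤ) :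
    rotDer 2 (rotDer 2 (rawHarmonic l m)) = (-(m : ℝ) ^ 2) • rawHarmonic l m := by
  rw [rotDer_two_rawHarmonic, Derivation.map_smul, rotDer_two_rawHarmonic, smul_smul, neg_neg]
  congr 1
  push_cast
  ring

/-- Distinct degrees are distinct eigenvalues of the symmetric L². For equal degrees and m' ≠ ±m,
the symmetric X_3² separates by its eigenvalues -m². For m' = -m, X_3 exchanges the two functions up
to a factor and ⟨X_3 f, f⟩ = 0 by skew-symmetry. -/
theorem inner_rawHarmonic_eq_zero {l l' : ℕ} {m m' : ℤ} (h : (l, m) ≠ (l', m')) :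
    ⟪toL2 (rawHarmonic l m), toL2 (rawHarmonic l' m')⟫_ℝ = 0 := by
  by_cases hl : l = l'
  · subst hl
    have hm : m ≠ m' := fun hm => h (by rw [hm])
    by_cases hn : m' = -m
    · subst hn
      have h1 := inner_rotDer 2 (rawHarmonic l m) (rawHarmonic l m)
      rw [rotDer_two_rawHarmonic, map_smul, real_inner_smul_left, real_inner_smul_right,
        real_inner_comm] at h1
      have h0 : (m : ℝ) ≠ 0 := by
        rw [Int.cast_ne_zero]
        omega
      have h2 : (m : ℝ) * ⟪toL2 (rawHarmonic l m), toL2 (rawHarmonic l (-m))⟫_ℝ = 0 := by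
        linarith
      exact (mul_eq_zero.1 h2).resolve_left h0
    · have h1 := inner_rotDer 2 (rotDer 2 (rawHarmonic l m)) (rawHarmonic l m')
      rw [inner_rotDer 2 (rawHarmonic l m), neg_neg, rotDer_two_rotDer_two_rawHarmonic,
        rotDer_two_rotDer_two_rawHarmonic, map_smul, map_smul, real_inner_smul_left,
        real_inner_smul_right] at h1
      have h0 : (m : ℝ) ^ 2 - m' ^ 2 ≠ 0 := by
        rw [sub_ne_zero]
        exact_mod_cast fun hs => (sq_eq_sq_iff_eq_or_eq_neg.1 hs).elim hm
          fun h' => hn (by rw [h', neg_neg])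
      refine (mul_eq_zero.1 (?_ : ((m : ℝ) ^ 2 - m' ^ 2) * _ = 0)).resolve_left h0
      linarith
  · have h1 := inner_angularMomentumSq (rawHarmonic l m) (rawHarmonic l' m')
    rw [angularMomentumSq_rawHarmonic, angularMomentumSq_rawHarmonic, map_smul, map_smul,
      real_inner_smul_left, real_inner_smul_right] at h1
    have h0 : (l : ℝ) - l' ≠ 0 := sub_ne_zero.2 (Nat.cast_injective.ne hl)
    have h2 : (l : ℝ) + l' + 1 ≠ 0 := by positivity
    refine (mul_eq_zero.1 (?_ : (((l : ℝ) - l') * (l + l' + 1)) * _ = 0)).resolve_left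
      (mul_ne_zero h0 h2)
    linarith

theorem exists_point_of_polar {t : ℝ} (ht : t ∈ Set.Ioo (-1 : ℝ) 1) (φ : ℝ) :
    ∃ x : S2, (x : EuclideanSpace ℝ (Fin 3)) 2 = t ∧ ∃ s : ℝ, 0 < s ∧ ∀ n : ℕ,
      planarRe n x = s ^ n * Real.cos (n * φ) ∧ planarIm n x = s ^ n * Real.sin (n * φ) := by
  have hs : 0 < 1 - t ^ 2 := by nlinarith [ht.1, ht.2]
  have hs2 := Real.sq_sqrt hs.le
  refine ⟨⟨!₂[√(1 - t ^ 2) * Real.cos φ, √(1 - t ^ 2) * Real.sin φ, t], ?_⟩, rfl,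
    √(1 - t ^ 2), Real.sqrt_pos.2 hs, fun n => ?_⟩
  · rw [mem_sphere_zero_iff_norm, EuclideanSpace.norm_eq, Real.sqrt_eq_one, Fin.sum_univ_three]
    simp only [Real.norm_eq_abs, sq_abs, Matrix.cons_val]
    linear_combination hs2 + (√(1 - t ^ 2)) ^ 2 * Real.cos_sq_add_sin_sq φ
  · set x : S2 := ⟨!₂[√(1 - t ^ 2) * Real.cos φ, √(1 - t ^ 2) * Real.sin φ, t], _⟩
    have h := planarHarmonic_eval n x
    have h2 : (⟨(x : EuclideanSpace ℝ (Fin 3)) 0, (x : EuclideanSpace ℝ (Fin 3)) 1⟩ : ℂ) =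
        (√(1 - t ^ 2) : ℝ) * (Complex.cos φ + Complex.sin φ * Complex.I) := by
      apply Complex.ext <;> simp [x, ← Complex.ofReal_cos, ← Complex.ofReal_sin]
    have h3 : (n : ℂ) * φ = ((n * φ : ℝ) : ℂ) := by push_cast; rfl
    rw [h2, mul_pow, Complex.cos_add_sin_mul_I_pow, h3, ← Complex.ofReal_cos,
      ← Complex.ofReal_sin, ← Complex.ofReal_pow] at h
    have hre := congrArg Complex.re h
    have him := congrArg Complex.im h
    rw [Complex.re_ofReal_mul] at hre
    rw [Complex.im_ofReal_mul] at him
    simp only [Complex.add_re, Complex.add_im, Complex.mul_re, Complex.mul_im, Complex.ofReal_re,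
      Complex.ofReal_im, Complex.I_re, Complex.I_im, mul_zero, mul_one, sub_zero, add_zero,
      zero_add] at hre him
    exact ⟨hre.symm, him.symm⟩

theorem rawHarmonic_ne_zero {l : ℕ} {m : ℤ} (h : |m| ≤ (l : ℤ)) : rawHarmonic l m ≠ 0 := by
  intro h0
  rw [Int.abs_eq_natAbs] at h
  obtain ⟨d, hd⟩ : ∃ d, l = m.natAbs + d := Nat.exists_eq_add_of_le (by omega)
  have hP : Polynomial.derivative^[m.natAbs] (legendre l) ≠ 0 := fun hP => by
    have := degree_iterate_derivative_legendre d m.natAbs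
    rw [← hd, hP] at this
    simp at this
  obtain ⟨t, ht, htP⟩ : ∃ t ∈ Set.Ioo (-1 : ℝ) 1,
      ¬ (Polynomial.derivative^[m.natAbs] (legendre l)).IsRoot t := by
    by_contra! hc
    exact (Set.Ioo_infinite (by norm_num : (-1 : ℝ) < 1))
      ((Polynomial.finite_setOfPred_isRoot hP).subset hc)
  -- With this longitude φ, |m|φ lies in [0, 1), where the cosine is positive, and so is the sine
  -- unless m = 0.
  obtain ⟨x, hx, s, hs, hr⟩ := exists_point_of_polar ht (1 / (m.natAbs + 1))
  have h1 : zonal (Polynomial.derivative^[m.natAbs] (legendre l)) x * planar m x = 0 := by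
    have := congrArg (fun f : SmoothFun => f x) h0
    rwa [rawHarmonic_eq] at this
  rw [zonal_apply, hx] at h1
  have h2 := (mul_eq_zero.1 h1).resolve_left htP
  have h3 : (m.natAbs : ℝ) * (1 / (m.natAbs + 1)) ≤ 1 := by
    rw [mul_one_div, div_le_one (by positivity)]
    linarith
  have h4 : 0 ≤ (m.natAbs : ℝ) * (1 / (m.natAbs + 1)) := by positivity
  rw [planar] at h2
  split_ifs at h2 with hm
  · rw [(hr _).1] at h2
    refine (mul_pos (pow_pos hs _) (Real.cos_pos_of_mem_Ioo ⟨?_, ?_⟩)).ne' h2 <;>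
    linarith [Real.pi_gt_three]
  · rw [(hr _).2] at h2
    refine (mul_pos (pow_pos hs _) (Real.sin_pos_of_pos_of_lt_pi ?_ ?_)).ne' h2
    · have : 0 < m.natAbs := by omega
      positivity
    · linarith [Real.pi_gt_three]

/-- The index set of the spherical harmonics. -/
abbrev Idx : Type := {q : ℕ × ℤ // |q.2| ≤ (q.1 : ℤ)}

theorem orthonormal_Y : Orthonormal ℝ fun q : Idx => toL2 (Y q.1.1 q.1.2) := by
  constructor
  · intro q
    have h : ‖toL2 (rawHarmonic q.1.1 q.1.2)‖ ≠ 0 := by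
      rw [norm_ne_zero_iff, ← map_zero toL2]
      exact toL2_injective.ne (rawHarmonic_ne_zero q.2)
    change ‖toL2 (Y _ _)‖ = 1
    rw [Y, map_smul, norm_smul, norm_inv, norm_norm, inv_mul_cancel₀ h]
  · intro q q' h
    simp only [Y, map_smul]
    rw [real_inner_smul_left, real_inner_smul_right, inner_rawHarmonic_eq_zero
      (fun h' => h (Subtype.ext h')), mul_zero, mul_zero]

/-! ### Completeness of the spherical harmonics -/

/-- The linear span of the spherical harmonics. -/
def harmonicSpan : Submodule ℝ SmoothFun :=
  Submodule.span ℝ (Set.range fun q : Idx => Y q.1.1 q.1.2)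

theorem rawHarmonic_mem_harmonicSpan {l : ℕ} {m : ℤ} (h : |m| ≤ (l : ℤ)) :
    rawHarmonic l m ∈ harmonicSpan := by
  have h1 : ‖toL2 (rawHarmonic l m)‖ ≠ 0 := by
    rw [norm_ne_zero_iff, ← map_zero toL2]
    exact toL2_injective.ne (rawHarmonic_ne_zero h)
  have h2 : rawHarmonic l m = ‖toL2 (rawHarmonic l m)‖ • Y l m := by
    rw [Y, smul_inv_smul₀ h1]
  rw [h2]
  exact harmonicSpan.smul_mem _ (Submodule.subset_span ⟨⟨(l, m), h⟩, rfl⟩)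

/-- The derivatives of order `m` of the Legendre polynomials of degrees `m, m + 1, …`. -/
def legendreSequence (m : ℕ) : Polynomial.Sequence ℝ where
  elems' l := Polynomial.derivative^[m] (legendre (m + l))
  degree_eq' l := degree_iterate_derivative_legendre l m

/-- For fixed m the polynomial factors of the harmonics have degrees 0, 1, 2, …, so they span all
polynomials. -/
theorem zonal_mul_planar_mem (P : Polynomial ℝ) (m : ℤ) :
    zonal P * planar m ∈ harmonicSpan := by
  have h : P ∈ Submodule.span ℝ (Set.range (legendreSequence m.natAbs)) := by
    rw [(legendreSequence m.natAbs).span fun l =>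
      (Polynomial.leadingCoeff_ne_zero.2 ((legendreSequence m.natAbs).ne_zero l)).isUnit]
    trivial
  induction h using Submodule.span_induction with
  | mem P hP =>
    obtain ⟨l, rfl⟩ := hP
    have h2 := rawHarmonic_mem_harmonicSpan (l := m.natAbs + l) (m := m)
      (by rw [Int.abs_eq_natAbs]; omega)
    rwa [rawHarmonic_eq] at h2
  | zero => simp
  | add P Q _ _ hP hQ =>
    rw [map_add, add_mul]
    exact harmonicSpan.add_mem hP hQ
  | smul c P _ hP =>
    rw [map_smul, smul_mul_assoc]
    exact harmonicSpan.smul_mem c hP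

theorem zonal_mul_planarRe_mem (P : Polynomial ℝ) (m : ℕ) :
    zonal P * planarRe m ∈ harmonicSpan := by
  have h := zonal_mul_planar_mem P m
  rwa [planar, if_pos (Int.natCast_nonneg m), Int.natAbs_natCast] at h

theorem zonal_mul_planarIm_mem (P : Polynomial ℝ) (m : ℕ) :
    zonal P * planarIm m ∈ harmonicSpan := by
  cases m with
  | zero => simp [planarIm_zero]
  | succ m =>
    have h := zonal_mul_planar_mem P (-(m + 1 : ℕ))
    rwa [planar, if_neg (by omega), Int.natAbs_neg, Int.natAbs_natCast] at h

theorem zonal_X : zonal Polynomial.X = coordFun 2 := Polynomial.aeval_X _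

theorem zonal_one_sub_sq :
    zonal (1 - Polynomial.X ^ 2) = coordFun 0 ^ 2 + coordFun 1 ^ 2 := by
  rw [map_sub, map_pow, zonal_X, map_one]
  linear_combination -coordFun_sq_add

/-- The third coordinate is absorbed into P. For the others let w = x + iy: then 2x = w + w̄ and w
w̄ = 1 - z² give 2x w^(m+1) = w^(m+2) + (1 - z²)w^m, and similarly for y. The factor 1 - z² goes
into P. -/
theorem coordFun_mul_zonal_mul_planar_mem (j : Fin 3) (P : Polynomial ℝ) (m : ℕ) :
    coordFun j * (zonal P * planarRe m) ∈ harmonicSpan ∧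
      coordFun j * (zonal P * planarIm m) ∈ harmonicSpan := by
  -- Smooth functions do not form a field, so the factor 1/2 enters as a constant polynomial subject
  -- to this relation.
  have h2 : zonal (Polynomial.C (1 / 2)) * 2 = 1 := by
    rw [← map_ofNat zonal 2, ← map_mul, ← map_one zonal, ← map_ofNat Polynomial.C 2,
      ← Polynomial.C_mul]
    norm_num
  by_cases hj : j = 2
  · subst hj
    rw [← zonal_X, ← mul_assoc, ← mul_assoc, ← map_mul]
    exact ⟨zonal_mul_planarRe_mem _ _, zonal_mul_planarIm_mem _ _⟩
  cases m with
  | zero =>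
    rw [planarIm_zero, mul_zero, mul_zero]
    refine ⟨?_, zero_mem _⟩
    have hj' : j = 0 ∨ j = 1 := by fin_cases j <;> simp_all
    rcases hj' with rfl | rfl
    · convert zonal_mul_planarRe_mem P 1 using 1
      rw [planarRe_succ, planarIm_zero]
      ring
    · convert zonal_mul_planarIm_mem P 1 using 1
      rw [planarIm_succ, planarIm_zero]
      ring
  | succ m =>
    set H := Polynomial.C (1 / 2 : ℝ)
    have hRe := zonal_mul_planarRe_mem (H * P) (m + 2)
    have hIm := zonal_mul_planarIm_mem (H * P) (m + 2)
    have hRe' := zonal_mul_planarRe_mem (H * P * (1 - Polynomial.X ^ 2)) m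
    have hIm' := zonal_mul_planarIm_mem (H * P * (1 - Polynomial.X ^ 2)) m
    rw [map_mul, zonal_one_sub_sq, map_mul] at hRe' hIm'
    rw [map_mul, planarRe_succ, planarRe_succ, planarIm_succ] at hRe
    rw [map_mul, planarIm_succ, planarRe_succ, planarIm_succ] at hIm
    rw [planarRe_succ, planarIm_succ]
    have hj' : j = 0 ∨ j = 1 := by fin_cases j <;> simp_all
    rcases hj' with rfl | rfl
    · constructor
      · convert harmonicSpan.add_mem hRe hRe' using 1
        linear_combination
          (-(coordFun 0 * (zonal P * (coordFun 0 * planarRe m - coordFun 1 * planarIm m)))) * h2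
      · convert harmonicSpan.add_mem hIm hIm' using 1
        linear_combination
          (-(coordFun 0 * (zonal P * (coordFun 0 * planarIm m + coordFun 1 * planarRe m)))) * h2
    · constructor
      · convert harmonicSpan.sub_mem hIm hIm' using 1
        linear_combination
          (-(coordFun 1 * (zonal P * (coordFun 0 * planarRe m - coordFun 1 * planarIm m)))) * h2
      · convert harmonicSpan.sub_mem hRe' hRe using 1
        linear_combination
          (-(coordFun 1 * (zonal P * (coordFun 0 * planarIm m + coordFun 1 * planarRe m)))) * h2

theorem coordFun_mul_mem_harmonicSpan (j : Fin 3) {f : SmoothFun} (hf : f ∈ harmonicSpan) :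
    coordFun j * f ∈ harmonicSpan := by
  induction hf using Submodule.span_induction with
  | mem f hf =>
    obtain ⟨q, rfl⟩ := hf
    simp only [Y]
    rw [mul_smul_comm, rawHarmonic_eq, planar]
    refine harmonicSpan.smul_mem _ ?_
    split_ifs
    exacts [(coordFun_mul_zonal_mul_planar_mem j _ _).1,
      (coordFun_mul_zonal_mul_planar_mem j _ _).2]
  | zero => simp
  | add f g _ _ hf hg =>
    rw [mul_add]
    exact harmonicSpan.add_mem hf hg
  | smul c f _ hf =>
    rw [mul_smul_comm]
    exact harmonicSpan.smul_mem c hf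

theorem adjoin_coordFun_le_harmonicSpan :
    (Algebra.adjoin ℝ (Set.range coordFun)).toSubmodule ≤ harmonicSpan := by
  have h : ∀ f ∈ Algebra.adjoin ℝ (Set.range coordFun), ∀ g ∈ harmonicSpan,
      f * g ∈ harmonicSpan := by
    intro f hf
    induction hf using Algebra.adjoin_induction with
    | mem f hf =>
      obtain ⟨j, rfl⟩ := hf
      exact fun g => coordFun_mul_mem_harmonicSpan j
    | algebraMap c =>
      intro g hg
      rw [← Algebra.smul_def]
      exact harmonicSpan.smul_mem c hg
    | add f f' _ _ hf hf' =>
      intro g hg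
      rw [add_mul]
      exact harmonicSpan.add_mem (hf g hg) (hf' g hg)
    | mul f f' _ _ hf hf' =>
      intro g hg
      rw [mul_assoc]
      exact hf _ (hf' g hg)
  intro f hf
  rw [← mul_one f]
  refine h f hf 1 ?_
  simpa [planarRe_zero] using zonal_mul_planarRe_mem 1 0

/-- The inclusion of the smooth functions in the continuous ones. -/
def toContinuous : SmoothFun →ₐ[ℝ] C(S2, ℝ) where
  toFun f := ⟨f, f.contMDiff.continuous⟩
  map_one' := rfl
  map_mul' _ _ := rfl
  map_zero' := rfl
  map_add' _ _ := rfl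
  commutes' _ := rfl

/-- Polynomials in the coordinates separate points, hence are uniformly dense in the continuous
functions, whose image in L² is dense. -/
theorem topologicalClosure_span_toL2_Y :
    (Submodule.span ℝ (Set.range fun q : Idx => toL2 (Y q.1.1 q.1.2))).topologicalClosure = ⊤ := by
  set A := (Algebra.adjoin ℝ (Set.range coordFun)).map toContinuous with hA
  have hsep : A.SeparatesPoints := by
    intro x y hxy
    obtain ⟨j, hj⟩ : ∃ j, (x : EuclideanSpace ℝ (Fin 3)) j ≠ (y : EuclideanSpace ℝ (Fin 3)) j := by
      by_contra! hc
      exact hxy (Subtype.ext (PiLp.ext hc))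
    exact ⟨_, ⟨_, ⟨_, Algebra.subset_adjoin ⟨j, rfl⟩, rfl⟩, rfl⟩, hj⟩
  have h1 := ContinuousMap.subalgebra_topologicalClosure_eq_top_of_separatesPoints A hsep
  have h2 : A.toSubmodule.topologicalClosure = ⊤ := by
    have := congrArg Subalgebra.toSubmodule h1
    rwa [Algebra.top_toSubmodule] at this
  have h3 := (ContinuousMap.toLp_denseRange ℝ surfaceMeasure ℝ
    (p := 2) (by simp)).topologicalClosure_map_submodule h2
  rw [eq_top_iff, ← h3]
  refine Submodule.topologicalClosure_mono ?_
  rintro _ ⟨_, ⟨f, hf, rfl⟩, rfl⟩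
  have h4 : toL2 f ∈ harmonicSpan.map toL2 :=
    Submodule.mem_map_of_mem (adjoin_coordFun_le_harmonicSpan hf)
  rw [harmonicSpan, Submodule.map_span, ← Set.range_comp] at h4
  exact h4

/-- The spherical harmonics as a Hilbert basis of `L²(S2)`. -/
def harmonicBasis : HilbertBasis Idx ℝ (Lp ℝ 2 surfaceMeasure) :=
  HilbertBasis.mk orthonormal_Y topologicalClosure_span_toL2_Y.ge

/-! ### Convergence and uniqueness of the expansion -/

section Expansion

open scoped InnerProductSpace

theorem harmonicBasis_apply (q : Idx) : harmonicBasis q = toL2 (Y q.1.1 q.1.2) :=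
  congrFun (HilbertBasis.coe_mk orthonormal_Y topologicalClosure_span_toL2_Y.ge) q

theorem coeff_eq_inner (f : SmoothFun) (l : ℕ) (m : ℤ) :
    coeff f l m = ⟪toL2 (Y l m), toL2 f⟫_ℝ := by
  rw [inner_toL2, mul_comm]
  rfl

theorem opA_pow_Y (k : ℝ) (p l : ℕ) (m : ℤ) :
    (opA k ^ p) (Y l m) = ((l : ℝ) * (l + 1) + k) ^ p • Y l m := by
  induction p with
  | zero => simp
  | succ p ih =>
    rw [pow_succ', Module.End.mul_apply, ih, map_smul, opA, LinearMap.add_apply, Y, map_smul,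
      angularMomentumSq_rawHarmonic]
    simp only [LinearMap.smul_apply, LinearMap.id_apply, smul_smul, ← add_smul]
    congr 1
    ring

/-- The indices of degree at most `n`. -/
def idxFinset (n : ℕ) : Finset Idx :=
  (Finset.range (n + 1) ×ˢ Finset.Icc (-(n : ℤ)) n).subtype _

theorem mem_idxFinset {n : ℕ} {q : Idx} : q ∈ idxFinset n ↔ q.1.1 ≤ n := by
  have h := q.2
  simp only [idxFinset, Finset.mem_subtype, Finset.mem_product, Finset.mem_range, Finset.mem_Icc]
  rw [abs_le] at h
  omega

/-- Turns the unconditional sum over the Hilbert basis into convergence of the partial sums by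
degree. -/
theorem tendsto_idxFinset : Tendsto idxFinset atTop atTop :=
  tendsto_atTop_finset_of_monotone
    (fun _ _ h _ hq => mem_idxFinset.2 ((mem_idxFinset.1 hq).trans h))
    fun q => ⟨q.1.1, mem_idxFinset.2 le_rfl⟩

theorem partialSum_eq (c : ℕ → ℤ → ℝ) (n : ℕ) :
    partialSum c n = ∑ q ∈ idxFinset n, c q.1.1 q.1.2 • Y q.1.1 q.1.2 := by
  rw [partialSum, Finset.sum_sigma']
  symm
  refine Finset.sum_bij (fun q _ => ⟨q.1.1, q.1.2⟩) ?_ ?_ ?_ ?_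
  · intro q hq
    have h := abs_le.1 q.2
    have h2 := mem_idxFinset.1 hq
    simp only [Finset.mem_sigma, Finset.mem_range, Finset.mem_Icc]
    exact ⟨by omega, h⟩
  · rintro ⟨⟨l, m⟩, h⟩ _ ⟨⟨l', m'⟩, h'⟩ _ heq
    simpa using heq
  · rintro ⟨l, m⟩ h
    simp only [Finset.mem_sigma, Finset.mem_range, Finset.mem_Icc] at h
    exact ⟨⟨(l, m), abs_le.2 h.2⟩, mem_idxFinset.2 (by simp only; omega), rfl⟩
  · intro q _
    rfl

theorem coeff_Y_self {l : ℕ} {m : ℤ} (hm : |m| ≤ (l : ℤ)) : coeff (Y l m) l m = 1 := by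
  have h : ‖toL2 (Y l m)‖ = 1 := orthonormal_Y.1 (⟨(l, m), hm⟩ : Idx)
  rw [coeff_eq_inner, real_inner_self_eq_norm_sq, h, one_pow]

theorem coeff_Y_of_ne {l l' : ℕ} {m m' : ℤ} (h : (l, m) ≠ (l', m')) :
    coeff (Y l m) l' m' = 0 := by
  rw [coeff_eq_inner]
  simp only [Y, map_smul]
  rw [real_inner_smul_left, real_inner_smul_right, inner_rawHarmonic_eq_zero h.symm, mul_zero,
    mul_zero]

theorem coeff_partialSum (c : ℕ → ℤ → ℝ) {n l : ℕ} {m : ℤ} (hl : l ≤ n) (hm : |m| ≤ (l : ℤ)) :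
    coeff (partialSum c n) l m = c l m := by
  let q₀ : Idx := ⟨(l, m), hm⟩
  rw [coeff_eq_inner, partialSum_eq, map_sum, inner_sum, Finset.sum_eq_single q₀]
  · rw [map_smul, real_inner_smul_right, ← coeff_eq_inner, coeff_Y_self hm, mul_one]
  · intro q _ hq
    rw [map_smul, real_inner_smul_right, ← coeff_eq_inner,
      coeff_Y_of_ne fun h => hq (Subtype.ext h), mul_zero]
  · intro h
    exact absurd (mem_idxFinset.2 hl) h

/-- Symmetry moves A^p from f onto the eigenvector Y, so the terms on the left are those of the
Hilbert expansion of A^p f. -/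
theorem tendsto_opA_pow_partialSum (k : ℝ) (p : ℕ) (f : SmoothFun) :
    Tendsto (fun n => toL2 ((opA k ^ p) (partialSum (coeff f) n))) atTop
      (𝓝 (toL2 ((opA k ^ p) f))) := by
  refine ((harmonicBasis.hasSum_repr (toL2 ((opA k ^ p) f))).comp tendsto_idxFinset).congr
    fun n => ?_
  rw [partialSum_eq, map_sum, map_sum]
  refine Finset.sum_congr rfl fun q _ => ?_
  change harmonicBasis.repr (toL2 ((opA k ^ p) f)) q • harmonicBasis q = _
  rw [HilbertBasis.repr_apply_apply, harmonicBasis_apply, ← inner_opA_pow, map_smul, opA_pow_Y,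
    map_smul, map_smul, map_smul, real_inner_smul_left, coeff_eq_inner, smul_smul, mul_comm]

theorem tendsto_norm_opA_pow_sub_partialSum (k : ℝ) (p : ℕ) (f : SmoothFun) :
    Tendsto (fun n => ‖toL2 ((opA k ^ p) (f - partialSum (coeff f) n))‖) atTop (𝓝 0) := by
  have h := ((tendsto_opA_pow_partialSum k p f).const_sub (toL2 ((opA k ^ p) f))).norm
  rw [sub_self, norm_zero] at h
  simpa only [map_sub] using h

theorem tendsto_partialSum (k : ℝ) (f : SmoothFun) :
    letI := frechetTopology k
    Tendsto (partialSum (coeff f)) atTop (𝓝 f) := by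
  let _ := frechetTopology k
  refine ((withSeminorms k).tendsto_nhds _ _).2 fun p ε hε => ?_
  filter_upwards [(tendsto_norm_opA_pow_sub_partialSum k p f).eventually_lt_const hε] with n hn
  rw [map_sub_rev]
  exact hn

theorem continuous_toL2 (k : ℝ) :
    letI := frechetTopology k
    Continuous toL2 := by
  let _ := frechetTopology k
  have : IsTopologicalAddGroup SmoothFun := (withSeminorms k).topologicalAddGroup
  refine continuous_of_continuousAt_zero toL2 ?_
  -- The index p = 0 gives the L² norm itself.
  have h : Continuous fun f => ‖toL2 f‖ := (withSeminorms k).continuous_seminorm 0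
  rw [ContinuousAt, map_zero, tendsto_zero_iff_norm_tendsto_zero]
  simpa using h.tendsto 0

theorem continuous_coeff (k : ℝ) (l : ℕ) (m : ℤ) :
    letI := frechetTopology k
    Continuous fun f => coeff f l m := by
  let _ := frechetTopology k
  simp only [coeff_eq_inner]
  exact continuous_const.inner (continuous_toL2 k)

/-- The coefficient at (l, m) is continuous, and on the partial sums it is constantly c l m once n ≥
l. -/
theorem eq_coeff_of_tendsto (k : ℝ) (f : SmoothFun) (c : ℕ → ℤ → ℝ)
    (h : letI := frechetTopology k; Tendsto (partialSum c) atTop (𝓝 f)) {l : ℕ} {m : ℤ}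
    (hm : |m| ≤ (l : ℤ)) : c l m = coeff f l m := by
  let _ := frechetTopology k
  refine tendsto_nhds_unique (tendsto_const_nhds.congr' ?_)
    (((continuous_coeff k l m).tendsto f).comp h)
  filter_upwards [eventually_ge_atTop l] with n hn
  exact (coeff_partialSum c hn hm).symm

end Expansion

/-! ### The direct sum decomposition -/

/-- The projection onto the span of the spherical harmonics with `l ≤ 1`. -/
def projT4 : SmoothFun →ₗ[ℝ] SmoothFun where
  toFun f := partialSum (coeff f) 1
  map_add' f g := by
    simp only [partialSum, coeff_eq_inner, map_add, inner_add_right, add_smul,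
      Finset.sum_add_distrib]
  map_smul' c f := by
    simp only [partialSum, coeff_eq_inner, map_smul, real_inner_smul_right, mul_smul,
      Finset.smul_sum, RingHom.id_apply]

theorem projT4_apply (f : SmoothFun) : projT4 f = partialSum (coeff f) 1 := rfl

theorem continuous_projT4 (k : ℝ) :
    letI := frechetTopology k
    Continuous projT4 := by
  let _ := frechetTopology k
  have : IsTopologicalAddGroup SmoothFun := (withSeminorms k).topologicalAddGroup
  have : ContinuousSMul ℝ SmoothFun := (withSeminorms k).continuousSMul
  change Continuous fun f => partialSum (coeff f) 1
  exact continuous_finsetSum _ fun l _ => continuous_finsetSum _ fun m _ =>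
    (continuous_coeff k l m).smul continuous_const

theorem projT4_mem_T4 (f : SmoothFun) : projT4 f ∈ T4 := by
  rw [projT4_apply, partialSum_eq]
  exact T4.sum_mem fun q hq => T4.smul_mem _
    (Submodule.subset_span ⟨_, _, mem_idxFinset.1 hq, q.2, rfl⟩)

theorem projT4_Y_of_le {l : ℕ} {m : ℤ} (hl : l ≤ 1) (hm : |m| ≤ (l : ℤ)) :
    projT4 (Y l m) = Y l m := by
  let q₀ : Idx := ⟨(l, m), hm⟩
  rw [projT4_apply, partialSum_eq, Finset.sum_eq_single q₀]
  · rw [coeff_Y_self hm, one_smul]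
  · intro q _ hq
    rw [coeff_Y_of_ne fun h => hq (Subtype.ext h.symm), zero_smul]
  · intro h
    exact absurd (mem_idxFinset.2 hl) h

theorem projT4_Y_of_lt {l : ℕ} {m : ℤ} (hl : 1 < l) : projT4 (Y l m) = 0 := by
  rw [projT4_apply, partialSum_eq]
  refine Finset.sum_eq_zero fun q hq => ?_
  have := mem_idxFinset.1 hq
  rw [coeff_Y_of_ne fun h => by simp only [Prod.ext_iff] at h; omega, zero_smul]

theorem projT4_eq_self {f : SmoothFun} (hf : f ∈ T4) : projT4 f = f := by
  induction hf using Submodule.span_induction with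
  | mem f hf =>
    obtain ⟨l, m, hl, hm, rfl⟩ := hf
    exact projT4_Y_of_le hl hm
  | zero => exact map_zero _
  | add f g _ _ hf hg => rw [map_add, hf, hg]
  | smul c f _ hf => rw [map_smul, hf]

theorem range_projT4 : LinearMap.range projT4 = T4 := by
  refine le_antisymm ?_ fun f hf => ⟨f, projT4_eq_self hf⟩
  rintro _ ⟨f, rfl⟩
  exact projT4_mem_T4 f

/-- The continuous injection `toL2` carries the condition into L², where points are closed;
`isClosed_T4` uses the same device. -/
theorem isClosed_ker_projT4 (k : ℝ) :
    letI := frechetTopology k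
    IsClosed (LinearMap.ker projT4 : Set SmoothFun) := by
  let _ := frechetTopology k
  have h : (LinearMap.ker projT4 : Set SmoothFun) = (fun f => toL2 (projT4 f)) ⁻¹' {0} := by
    ext f
    rw [SetLike.mem_coe, LinearMap.mem_ker, Set.mem_preimage, Set.mem_singleton_iff,
      map_eq_zero_iff _ toL2_injective]
  rw [h]
  exact isClosed_singleton.preimage ((continuous_toL2 k).comp (continuous_projT4 k))

theorem isClosed_T4 (k : ℝ) :
    letI := frechetTopology k
    IsClosed (T4 : Set SmoothFun) := by
  let _ := frechetTopology k
  have h : (T4 : Set SmoothFun) = {f | toL2 (projT4 f) = toL2 f} := by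
    ext f
    rw [SetLike.mem_coe, Set.mem_ofPred_eq, toL2_injective.eq_iff]
    exact ⟨projT4_eq_self, fun hf => hf ▸ projT4_mem_T4 f⟩
  rw [h]
  exact isClosed_eq ((continuous_toL2 k).comp (continuous_projT4 k)) (continuous_toL2 k)

theorem isClosed_ST (k : ℝ) :
    letI := frechetTopology k
    IsClosed (ST k : Set SmoothFun) := by
  let _ := frechetTopology k
  have : IsTopologicalAddGroup SmoothFun := (withSeminorms k).topologicalAddGroup
  have : ContinuousSMul ℝ SmoothFun := (withSeminorms k).continuousSMul
  exact Submodule.isClosed_topologicalClosure _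

/-- If the projection of f vanishes, so do its coefficients of degree at most 1; its partial sums
then lie in the span of the higher harmonics and converge to f. Conversely, the kernel is closed and
contains these harmonics. -/
theorem ker_projT4 (k : ℝ) : LinearMap.ker projT4 = ST k := by
  let _ := frechetTopology k
  have : IsTopologicalAddGroup SmoothFun := (withSeminorms k).topologicalAddGroup
  have : ContinuousSMul ℝ SmoothFun := (withSeminorms k).continuousSMul
  refine le_antisymm (fun f hf => ?_)
    (Submodule.topologicalClosure_minimal _ (Submodule.span_le.2 ?_) (isClosed_ker_projT4 k))
  · have hc : ∀ q : Idx, q.1.1 ≤ 1 → coeff f q.1.1 q.1.2 = 0 := fun q hq => by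
      rw [← coeff_partialSum (coeff f) hq q.2, ← projT4_apply, LinearMap.mem_ker.1 hf,
        coeff_eq_inner, map_zero, inner_zero_right]
    refine mem_closure_of_tendsto (tendsto_partialSum k f) (Eventually.of_forall fun n => ?_)
    rw [partialSum_eq]
    refine Submodule.sum_mem _ fun q _ => ?_
    by_cases hq : q.1.1 ≤ 1
    · rw [hc q hq, zero_smul]
      exact Submodule.zero_mem _
    · exact Submodule.smul_mem _ _ (Submodule.subset_span ⟨_, _, not_le.1 hq, q.2, rfl⟩)
  · rintro _ ⟨l, m, hl, -, rfl⟩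
    exact projT4_Y_of_lt hl

theorem isTopCompl_T4_ST (k : ℝ) :
    letI := frechetTopology k
    Submodule.IsTopCompl T4 (ST k) := by
  let _ := frechetTopology k
  let P : SmoothFun →L[ℝ] SmoothFun := ⟨projT4, continuous_projT4 k⟩
  -- The range and the kernel of a continuous idempotent are topological complements.
  have hP : IsIdempotentElem P := ContinuousLinearMap.ext fun f => projT4_eq_self (projT4_mem_T4 f)
  have h := ContinuousLinearMap.IsIdempotentElem.isTopCompl hP
  rw [← range_projT4, ← ker_projT4 k]
  exact h

end

end SphericalDecomposition

theorem mainTheorem2 (k : ℝ) (hk : 1 < k) :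
    letI : TopologicalSpace SphericalDecomposition.SmoothFun :=
      SphericalDecomposition.frechetTopology k
    -- `T4` and `ST` are closed, and the space of smooth functions is their topological direct sum
    IsClosed (SphericalDecomposition.T4 : Set SphericalDecomposition.SmoothFun) ∧
    IsClosed (SphericalDecomposition.ST k : Set SphericalDecomposition.SmoothFun) ∧
    Submodule.IsTopCompl SphericalDecomposition.T4 (SphericalDecomposition.ST k) ∧
    ∀ f : SphericalDecomposition.SmoothFun,
      -- the expansion of `f` converges to `f` in every norm `‖A ^ p ·‖`
      (∀ p : ℕ, Tendsto (fun n : ℕ => ‖SphericalDecomposition.toL2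
          ((SphericalDecomposition.opA k ^ p)
            (f - SphericalDecomposition.partialSum (SphericalDecomposition.coeff f) n))‖)
        atTop (𝓝 0)) ∧
      -- hence in the topology of the space of smooth functions
      Tendsto (SphericalDecomposition.partialSum (SphericalDecomposition.coeff f)) atTop (𝓝 f) ∧
      -- and it is the only such expansion
      ∀ c : ℕ → ℤ → ℝ, Tendsto (SphericalDecomposition.partialSum c) atTop (𝓝 f) →
        ∀ (l : ℕ) (m : ℤ), |m| ≤ (l : ℤ) → c l m = SphericalDecomposition.coeff f l m := by
  exact ⟨SphericalDecomposition.isClosed_T4 k, SphericalDecomposition.isClosed_ST k,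
    SphericalDecomposition.isTopCompl_T4_ST k, fun f =>
    ⟨fun p => SphericalDecomposition.tendsto_norm_opA_pow_sub_partialSum k p f,
      SphericalDecomposition.tendsto_partialSum k f,
      fun c hc _ _ hm => SphericalDecomposition.eq_coeff_of_tendsto k f c hc hm⟩⟩
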